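/- Let $K\ge 1$, $\sigma>0$ and $\delta\in(0,1)$. A graph dataset $\mathcal G=(\mathcal V,\mathcal E,\mathbf X,\mathbf Y)$ consists of a finite directed graph with binary adjacency matrix $\mathbf A$ (where $\mathbf A_{u,v}=1$ iff $(u,v)\in\mathcal E$), real node features $\mathbf X$ (one row per node), and labels $\mathbf Y$ whose rows are one-hot vectors, or zero for unlabeled nodes. Two graph datasets with the same $\mathcal V,\mathbf X,\mathbf Y$ are edge-level adjacent if one is obtained from the other by removing a single edge. A randomized algorithm $\mathcal A$ on graph datasets is edge-level $(\epsilon,\delta)$-differentially private if $\Pr[\mathcal A(\mathcal G)\in S]\le e^{\epsilon}\Pr[\mathcal A(\mathcal G')\in S]+\delta$ for all edge-level adjacent $\mathcal G,\mathcal G'$ and all measurable sets $S$ of outputs. The GAP training algorithm with $K$ hops and noise variance $\sigma^2$ runs on $\mathcal G$ as follows. 1. Pre-train an encoder $\mathrm{MLP}_{\mathrm{enc}}$: a (possibly randomized) training procedure that does not access the edges is applied to minimize, over $\Theta_{\mathrm{enc}}$ and $\mathbf W$, the total classification loss over the labeled nodes of the predictions $\mathrm{softmax}(\mathrm{MLP}_{\mathrm{enc}}(\mathbf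 X;\Theta_{\mathrm{enc}})\cdot\mathbf W)$; keep the resulting $\Theta_{\mathrm{enc}}^\star$. 2. Set $\mathbf X^{(0)}=\mathrm{MLP}_{\mathrm{enc}}(\mathbf X;\Theta_{\mathrm{enc}}^\star)$. 3. Divide every row of $\mathbf X^{(0)}$ by its Euclidean norm (zero rows are left zero) to obtain $\check{\mathbf X}^{(0)}$. 4. For $k=1,\dots,K$, set $\widetilde{\mathbf X}^{(k)}=\mathbf A^{T}\check{\mathbf X}^{(k-1)}+\mathbf Z^{(k)}$, where the $\mathbf Z^{(k)}$ have independent $\mathcal N(0,\sigma^2)$ entries and are independent of each other and of the earlier randomness, and divide every row of $\widetilde{\mathbf X}^{(k)}$ by its Euclidean norm to obtain $\check{\mathbf X}^{(k)}$. 5. Train the classification module: a (possibly randomized) training procedure with access only to $\check{\mathbf X}^{(0)},\dots,\check{\mathbf X}^{(K)}$ and $\mathbf Y$ is applied to minimize the total classification loss over the labeled nodes of the predictions $\mathrm{MLP}_{\mathrm{head}}(\mathbf H;\Theta_{\mathrm{head}})$, where $\mathbf H=\textsc{Combine}(\{\mathbf H^{(0)},\dots,\mathbf H^{(K)}\};\Theta_{\mathrm{comb}})$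 and $\mathbf H^{(k)}=\mathrm{MLP}^{(k)}_{\mathrm{base}}(\check{\mathbf X}^{(k)};\Theta^{(k)}_{\mathrm{base}})$. It returns the trained parameters $\{\Theta^\star_{\mathrm{enc}},\Theta_{\mathrm{base}}^{\star(0)},\dots,\Theta_{\mathrm{base}}^{\star(K)},\Theta^\star_{\mathrm{comb}},\Theta^\star_{\mathrm{head}}\}$. Then, for all network architectures, classification losses, combination strategies and training procedures, the GAP training algorithm satisfies edge-level $(\epsilon,\delta)$-differential privacy with $$\epsilon=\frac{K}{2\sigma^2}+\frac{\sqrt{2K\log(1/\delta)}}{\sigma}.$$ -/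

import Mathlib

open MeasureTheory ProbabilityTheory

noncomputable section

/-! ### Graph datasets, edge-level adjacency and differential privacy -/

/-- An `N × n` matrix of node features, one row of length `n` per node. -/
abbrev NodeMatrix (V : Type*) (n : ℕ) := V → Fin n → ℝ

/-- A directed graph dataset on the node set `V`, with `d`-dimensional node features and labels in
`C` classes. The label of a node is a one-hot vector, or the zero vector if the node is unlabeled. -/
structure GraphDataset (V : Type*) (d C : ℕ) where
  graph : Digraph V
  features : NodeMatrix V d
  labels : NodeMatrix V C
  labels_spec : ∀ v, labels v = 0 ∨ ∃ c, labels v = Pi.single c 1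

/-- The graph with the directed edge from `u` to `v` removed. -/
def Digraph.removeEdge {V : Type*} (G : Digraph V) (u v : V) : Digraph V where
  Adj x y := G.Adj x y ∧ ¬ (x = u ∧ y = v)

/-- `D'` is obtained from `D` by removing a single edge; features and labels are unchanged. -/
def GraphDataset.RemovesOneEdge {V : Type*} {d C : ℕ} (D D' : GraphDataset V d C) : Prop :=
  ∃ u v, D.graph.Adj u v ∧ D' = { D with graph := D.graph.removeEdge u v }

/-- Edge-level adjacency: one dataset is obtained by removing a single edge from the other. -/
def GraphDataset.EdgeAdjacent {V : Type*} {d C : ℕ} (D D' : GraphDataset V d C) : Prop :=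
  D.RemovesOneEdge D' ∨ D'.RemovesOneEdge D

/-- `(ε, δ)`-differential privacy of a randomized algorithm, given by its output laws, with respect
to an adjacency relation on the datasets. -/
def IsDP {𝒳 Ω : Type*} [MeasurableSpace Ω] (adj : 𝒳 → 𝒳 → Prop) (𝒜 : 𝒳 → Measure Ω)
    (ε δ : ℝ) : Prop :=
  ∀ x x', adj x x' → ∀ S : Set Ω, MeasurableSet S →
    𝒜 x S ≤ ENNReal.ofReal (Real.exp ε) * 𝒜 x' S + ENNReal.ofReal δ

/-- Edge-level `(ε, δ)`-differential privacy. -/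
def IsEdgeLevelDP {V Ω : Type*} [MeasurableSpace Ω] {d C : ℕ}
    (𝒜 : GraphDataset V d C → Measure Ω) (ε δ : ℝ) : Prop :=
  IsDP GraphDataset.EdgeAdjacent 𝒜 ε δ

/-! ### Private multi-hop aggregation -/

open Classical in
/-- The binary adjacency matrix: the entry at `(u, v)` is `1` iff there is an edge `u → v`. -/
def Digraph.adjacencyMatrix {V : Type*} (G : Digraph V) : Matrix V V ℝ :=
  Matrix.of fun u v => if G.Adj u v then 1 else 0

/-- Sum aggregation `Aᵀ X`. -/
def aggregate {V : Type*} [Fintype V] {m : ℕ} (G : Digraph V) (X : NodeMatrix V m) :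
    NodeMatrix V m :=
  G.adjacencyMatrix.transpose * Matrix.of X

/-- Division of every row by its Euclidean norm (a zero row stays zero). -/
def rowNormalize {V : Type*} {m : ℕ} (X : NodeMatrix V m) : NodeMatrix V m :=
  fun v j => X v j / ‖WithLp.toLp 2 (X v)‖

/-- `K` independent noise matrices with independent `N(0, σ²)` entries. -/
def gaussianNoise (V : Type*) [Fintype V] (m K : ℕ) (σ : ℝ) : Measure (Fin K → NodeMatrix V m) :=
  Measure.pi fun _ => Measure.pi fun _ => Measure.pi fun _ => gaussianReal 0 (Real.toNNReal (σ ^ 2))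

/-- The loop of the mechanism for given noise matrices `Z`: starting with the current normalized
features `X`, aggregate, add the next noise matrix, normalize, record the result, and repeat. -/
def pmaRun {V : Type*} [Fintype V] {m : ℕ} (G : Digraph V) :
    (K : ℕ) → NodeMatrix V m → (Fin K → NodeMatrix V m) → (Fin K → NodeMatrix V m)
  | 0, _, _ => Fin.elim0
  | K + 1, X, Z =>
      Fin.cons (rowNormalize (aggregate G X + Z 0))
        (pmaRun G K (rowNormalize (aggregate G X + Z 0)) (Fin.tail Z))

/-- The law of the output (hops `1, …, K`) of private multi-hop aggregation on the normalized
input features `X`. -/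
def pma {V : Type*} [Fintype V] {m : ℕ} (G : Digraph V) (K : ℕ) (σ : ℝ) (X : NodeMatrix V m) :
    Measure (Fin K → NodeMatrix V m) :=
  (gaussianNoise V m K σ).map (pmaRun G K X)

instance {V : Type*} [Fintype V] (m K : ℕ) (σ : ℝ) :
    IsProbabilityMeasure (gaussianNoise V m K σ) := by
  unfold gaussianNoise; infer_instance

lemma measurable_aggregate {V : Type*} [Fintype V] {m : ℕ} (G : Digraph V) :
    Measurable (aggregate G : NodeMatrix V m → NodeMatrix V m) := by
  refine measurable_pi_lambda _ fun v => measurable_pi_lambda _ fun j => ?_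
  simp only [aggregate, Matrix.mul_apply, Matrix.of_apply]
  fun_prop

lemma measurable_rowNormalize {V : Type*} {m : ℕ} :
    Measurable (rowNormalize : NodeMatrix V m → NodeMatrix V m) := by
  refine measurable_pi_lambda _ fun v => measurable_pi_lambda _ fun j => ?_
  simp only [rowNormalize]
  fun_prop

lemma measurable_finCons {α : Type*} [MeasurableSpace α] (K : ℕ) :
    Measurable (fun p : α × (Fin K → α) => (Fin.cons p.1 p.2 : Fin (K + 1) → α)) := by
  refine measurable_pi_lambda _ fun i => ?_
  refine Fin.cases ?_ (fun k => ?_) i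
  · simpa using measurable_fst
  · simp only [Fin.cons_succ]
    fun_prop

lemma measurable_pmaRun {V : Type*} [Fintype V] {m : ℕ} (G : Digraph V) (K : ℕ) :
    Measurable (fun p : NodeMatrix V m × (Fin K → NodeMatrix V m) => pmaRun G K p.1 p.2) := by
  induction K with
  | zero => exact measurable_pi_lambda _ fun i => i.elim0
  | succ K ih =>
    have h1 : Measurable (fun p : NodeMatrix V m × (Fin (K + 1) → NodeMatrix V m) =>
        rowNormalize (aggregate G p.1 + p.2 0)) :=
      measurable_rowNormalize.comp (((measurable_aggregate G).comp measurable_fst).add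
        ((measurable_pi_apply 0).comp measurable_snd))
    have h2 : Measurable (fun p : NodeMatrix V m × (Fin (K + 1) → NodeMatrix V m) =>
        Fin.tail p.2) :=
      measurable_pi_lambda _ fun i => (measurable_pi_apply i.succ).comp measurable_snd
    exact (measurable_finCons K).comp (h1.prodMk (ih.comp (h1.prodMk h2)))

/-- Private multi-hop aggregation as a Markov kernel from the normalized input features. -/
def pmaKernel {V : Type*} [Fintype V] (m : ℕ) (G : Digraph V) (K : ℕ) (σ : ℝ) :
    Kernel (NodeMatrix V m) (Fin K → NodeMatrix V m) where
  toFun := pma G K σ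
  measurable' := by
    have h : pma G K σ = fun X : NodeMatrix V m =>
        ((gaussianNoise V m K σ).map (Prod.mk X)).map (fun p => pmaRun G K p.1 p.2) := by
      funext X
      rw [Measure.map_map (measurable_pmaRun G K) measurable_prodMk_left]
      rfl
    rw [h]
    exact (Measure.measurable_map _ (measurable_pmaRun G K)).comp Measurable.map_prodMk_left

instance {V : Type*} [Fintype V] (m : ℕ) (G : Digraph V) (K : ℕ) (σ : ℝ) :
    IsMarkovKernel (pmaKernel m G K σ) where
  isProbabilityMeasure _ :=
    Measure.isProbabilityMeasure_map
      ((measurable_pmaRun G K).comp measurable_prodMk_left).aemeasurable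

/-! ### Multi-layer perceptrons and the architecture -/

/-- The architecture of a multi-layer perceptron with `a` inputs and `b` outputs: a list of fully
connected layers, each with its width and its activation. An activation acts on the vector of all
units of its layer, which covers entrywise nonlinearities as well as a softmax output layer. -/
inductive MLP : ℕ → ℕ → Type
  | nil (n : ℕ) : MLP n n
  | layer (a : ℕ) {b c : ℕ} (act : (Fin b → ℝ) → (Fin b → ℝ)) (hact : Measurable act)
      (rest : MLP b c) : MLP a c

namespace MLP

/-- The parameters: a weight matrix and a bias vector for every layer. -/
def Params : {a b : ℕ} → MLP a b → Type
  | _, _, nil _ => Unit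
  | _, _, @layer a b _ _ _ rest => ((Fin a → Fin b → ℝ) × (Fin b → ℝ)) × rest.Params

instance instMeasurableSpaceParams : {a b : ℕ} → (N : MLP a b) → MeasurableSpace N.Params
  | _, _, nil _ => inferInstanceAs (MeasurableSpace Unit)
  | _, _, @layer a b _ _ _ rest =>
      letI := instMeasurableSpaceParams rest
      inferInstanceAs
        (MeasurableSpace (((Fin a → Fin b → ℝ) × (Fin b → ℝ)) × rest.Params))

/-- The function computed by the network with given parameters. -/
def eval : {a b : ℕ} → (N : MLP a b) → N.Params → (Fin a → ℝ) → (Fin b → ℝ)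
  | _, _, nil _, _, x => x
  | _, _, @layer _ _ _ act _ rest, θ, x =>
      rest.eval θ.2 (act fun j => ∑ i, x i * θ.1.1 i j + θ.1.2 j)

lemma measurable_eval : {a b : ℕ} → (N : MLP a b) →
    Measurable (fun p : N.Params × (Fin a → ℝ) => N.eval p.1 p.2)
  | _, _, nil _ => measurable_snd
  | _, _, @layer a b c act hact rest => by
      have ih := measurable_eval rest
      have hθ : Measurable (fun p : (((Fin a → Fin b → ℝ) × (Fin b → ℝ)) × rest.Params) ×
          (Fin a → ℝ) => act fun j => ∑ i, p.2 i * p.1.1.1 i j + p.1.1.2 j) := by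
        refine hact.comp (measurable_pi_lambda _ fun j => ?_)
        fun_prop
      exact ih.comp ((measurable_snd.comp measurable_fst).prodMk hθ)

end MLP

/-- The softmax of a vector. -/
def softmax {C : ℕ} (z : Fin C → ℝ) : Fin C → ℝ :=
  fun c => Real.exp (z c) / ∑ c', Real.exp (z c')

open Classical in
/-- The labeled (training) nodes. -/
def trainNodes {V : Type*} [Fintype V] {C : ℕ} (Y : NodeMatrix V C) : Finset V :=
  Finset.univ.filter fun v => Y v ≠ 0

/-- The architecture of a GAP model with `K` hops: the encoder, the base networks for the
hops `0, …, K`, the combination strategy, the head, and the two classification losses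
(arguments: prediction, label). -/
structure GAPModel (V : Type*) (d C K : ℕ) where
  /-- dimension of the encoded features -/
  embDim : ℕ
  /-- the encoder network -/
  enc : MLP d embDim
  /-- loss for the pre-training of the encoder -/
  encLoss : (Fin C → ℝ) → (Fin C → ℝ) → ℝ
  /-- dimensions of the `k`-hop representations -/
  hidDim : Fin (K + 1) → ℕ
  /-- the base networks -/
  base : (k : Fin (K + 1)) → MLP embDim (hidDim k)
  /-- number of real parameters of the combination strategy -/
  combParams : ℕ
  /-- dimension of the combined node embedding -/
  combDim : ℕ
  /-- the combination strategy -/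
  combine : (Fin combParams → ℝ) → ((k : Fin (K + 1)) → NodeMatrix V (hidDim k)) →
    NodeMatrix V combDim
  /-- the head network -/
  head : MLP combDim C
  /-- loss for the training of the classification module -/
  clsLoss : (Fin C → ℝ) → (Fin C → ℝ) → ℝ

namespace GAPModel

variable {V : Type*} [Fintype V] {d C K : ℕ}

/-- Parameters of the encoder. -/
abbrev EncParams (M : GAPModel V d C K) := M.enc.Params

/-- Parameters in pre-training: those of the encoder and the weights of a linear softmax layer. -/
abbrev PretrainParams (M : GAPModel V d C K) := M.EncParams × (Fin M.embDim → Fin C → ℝ)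

/-- Parameters of the classification module: base networks, combination, head. -/
abbrev ClsParams (M : GAPModel V d C K) :=
  ((k : Fin (K + 1)) → (M.base k).Params) × (Fin M.combParams → ℝ) × M.head.Params

/-- Data for pre-training the encoder: node features and labels. -/
abbrev PretrainData (_M : GAPModel V d C K) := NodeMatrix V d × NodeMatrix V C

/-- Data for training the classification module: the normalized features of the
hops `0, …, K`, and the labels. -/
abbrev ClsData (M : GAPModel V d C K) := (Fin (K + 1) → NodeMatrix V M.embDim) × NodeMatrix V C

/-- The pre-training predictions `softmax (MLP_enc(X; θ) · W)`. -/
def encPredict (M : GAPModel V d C K) (X : NodeMatrix V d) (θ : M.PretrainParams) :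
    NodeMatrix V C :=
  fun v => softmax fun c => ∑ i, M.enc.eval θ.1 (X v) i * θ.2 i c

/-- The pre-training objective: the total loss over the training nodes. -/
def pretrainObjective (M : GAPModel V d C K) (D : M.PretrainData) (θ : M.PretrainParams) : ℝ :=
  ∑ v ∈ trainNodes D.2, M.encLoss (M.encPredict D.1 θ v) (D.2 v)

/-- The encoded node features. -/
def encode (M : GAPModel V d C K) (X : NodeMatrix V d) (θ : M.EncParams) :
    NodeMatrix V M.embDim :=
  fun v => M.enc.eval θ (X v)

/-- The predictions of the classification module. -/
def clsPredict (M : GAPModel V d C K) (X : Fin (K + 1) → NodeMatrix V M.embDim)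
    (θ : M.ClsParams) : NodeMatrix V C :=
  fun v => M.head.eval θ.2.2
    (M.combine θ.2.1 (fun k u => (M.base k).eval (θ.1 k) (X k u)) v)

/-- The objective of the classification module: the total loss over the training nodes. -/
def clsObjective (M : GAPModel V d C K) (D : M.ClsData) (θ : M.ClsParams) : ℝ :=
  ∑ v ∈ trainNodes D.2, M.clsLoss (M.clsPredict D.1 θ v) (D.2 v)

end GAPModel

lemma GAPModel.measurable_encode {V : Type*} {d C K : ℕ} (M : GAPModel V d C K)
    (X : NodeMatrix V d) : Measurable (M.encode X) :=
  measurable_pi_lambda _ fun _ => M.enc.measurable_eval.comp measurable_prodMk_right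

/-! ### The training algorithm -/

/-- A randomized training procedure for objectives with data in `𝒟` and parameters in `Θ`: it is
given the objective, as a function of data and parameters, and the data, and returns random
parameters. No quality of the minimization is required, so gradient methods with random
initialization and batches are covered as well as measurable selections of exact minimizers. -/
structure Trainer (𝒟 Θ : Type*) [MeasurableSpace 𝒟] [MeasurableSpace Θ] where
  train : (𝒟 → Θ → ℝ) → Kernel 𝒟 Θ
  isMarkovKernel : ∀ L, IsMarkovKernel (train L)

instance {𝒟 Θ : Type*} [MeasurableSpace 𝒟] [MeasurableSpace Θ] (T : Trainer 𝒟 Θ)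
    (L : 𝒟 → Θ → ℝ) : IsMarkovKernel (T.train L) :=
  T.isMarkovKernel L

section

variable {V : Type*} [Fintype V] {d C K : ℕ}

/-- Step 1: the law of the encoder parameters after pre-training (the weights of the softmax layer
are discarded). -/
def pretrainedEncoder (M : GAPModel V d C K) (T₁ : Trainer M.PretrainData M.PretrainParams)
    (D : GraphDataset V d C) : Measure M.EncParams :=
  (T₁.train M.pretrainObjective (D.features, D.labels)).map Prod.fst

/-- Steps 2 to 4: for given encoder parameters, encode and row-normalize the features to obtain hop
`0`, run private multi-hop aggregation to obtain the hops `1, …, K`, and attach the labels. -/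
def privateAggregates (M : GAPModel V d C K) (σ : ℝ) (D : GraphDataset V d C) :
    Kernel M.EncParams M.ClsData :=
  ((Kernel.id ×ₖ pmaKernel M.embDim D.graph K σ).map
      fun p => ((Fin.cons p.1 p.2 : Fin (K + 1) → NodeMatrix V M.embDim), D.labels)).comap
    (fun θ => rowNormalize (M.encode D.features θ))
    (measurable_rowNormalize.comp (M.measurable_encode D.features))

/-- The GAP training algorithm, as the joint law of the returned parameters: pre-train the encoder
(step 1), compute the private aggregations with it (steps 2 to 4), and train the classification
module on them (step 5). -/
def gapTraining (M : GAPModel V d C K) (T₁ : Trainer M.PretrainData M.PretrainParams)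
    (T₂ : Trainer M.ClsData M.ClsParams) (σ : ℝ) (D : GraphDataset V d C) :
    Measure (M.EncParams × M.ClsParams) :=
  (pretrainedEncoder M T₁ D) ⊗ₘ (T₂.train M.clsObjective ∘ₖ privateAggregates M σ D)

instance (M : GAPModel V d C K) (T₁ : Trainer M.PretrainData M.PretrainParams)
    (D : GraphDataset V d C) : IsProbabilityMeasure (pretrainedEncoder M T₁ D) :=
  Measure.isProbabilityMeasure_map measurable_fst.aemeasurable

instance (M : GAPModel V d C K) (σ : ℝ) (D : GraphDataset V d C) :
    IsMarkovKernel (privateAggregates M σ D) := by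
  have h : Measurable fun p : NodeMatrix V M.embDim × (Fin K → NodeMatrix V M.embDim) =>
      ((Fin.cons p.1 p.2 : Fin (K + 1) → NodeMatrix V M.embDim), D.labels) :=
    (measurable_finCons K).prodMk measurable_const
  have := Kernel.IsMarkovKernel.map (Kernel.id ×ₖ pmaKernel M.embDim D.graph K σ) h
  unfold privateAggregates
  infer_instance

instance (M : GAPModel V d C K) (T₁ : Trainer M.PretrainData M.PretrainParams)
    (T₂ : Trainer M.ClsData M.ClsParams) (σ : ℝ) (D : GraphDataset V d C) :
    IsProbabilityMeasure (gapTraining M T₁ T₂ σ D) := by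
  unfold gapTraining
  infer_instance

end

end

/-!
The privacy loss is tracked by Rényi divergences. Instead of the moment of the likelihood ratio,
`RenyiLE α ρ μ ν` expresses the bound `D_α(μ ‖ ν) ≤ ρ` in the form dual under Hölder's inequality,
`∫ f dμ ≤ (e^ρ ∫ f ^ q dν) ^ (1/q)` for all measurable `f ≥ 0`, where `q` is the exponent conjugate
to `α`. In this form, adaptive composition (`RenyiLE.compProd`) is one substitution of the
inequality for the inner integral into the inequality for the outer one, and no likelihood ratios
of the composed mechanism are needed.

For one hop, removing the edge `u → w` changes only the row `w` of `Aᵀ X`, and changes it by the row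
`u` of `X`, whose norm is at most `1` because the rows have been normalized. Gaussian noise of
variance `σ²` turns this sensitivity into the Rényi bound `α / (2σ²)`
(`RenyiLE.gaussianMatrix_map_const_add`). The result of a hop is normalized again, so the same bound
holds for the next hop whatever the result of the previous one, and composition gives `K α / (2σ²)`
for all hops (`GraphDataset.EdgeAdjacent.renyiLE_pma`).

A Rényi bound `ρ` implies `(ρ + log (1/δ) / (α - 1), δ)`-differential privacy, and it does so for
all test functions with values in `[0, 1]` and not only for indicators (`RenyiLE.lintegral_le`). The
probability that a randomized training procedure outputs an element of `S` is such a function of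
the noisy aggregates, so the training of the classification module costs nothing; the encoder is
trained without the edges, hence has the same law for both datasets, and is integrated out. The
stated `ε` is the minimum over `α` of `K α / (2σ²) + log (1/δ) / (α - 1)`.
-/

open scoped ENNReal NNReal

/-! ### Rényi divergence bounds in dual form -/

/-- The Rényi divergence of order `α` of `μ` from `ν` is at most `ρ`, expressed through Hölder's
inequality: for `α > 1` and `q = α / (α - 1)`, every measurable `f ≥ 0` satisfies
`∫ f dμ ≤ (e^ρ ∫ f ^ q dν) ^ (1/q)`. -/
def RenyiLE {Ω : Type*} [MeasurableSpace Ω] (α ρ : ℝ) (μ ν : Measure Ω) : Prop :=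
  ∀ f : Ω → ℝ≥0∞, Measurable f →
    ∫⁻ x, f x ∂μ ≤
      (ENNReal.ofReal (Real.exp ρ) * ∫⁻ x, f x ^ α.conjExponent ∂ν) ^ (α.conjExponent)⁻¹

namespace RenyiLE

variable {Ω Ω' : Type*} [MeasurableSpace Ω] [MeasurableSpace Ω'] {α ρ ρ' : ℝ} {μ ν : Measure Ω}

lemma conjExponent_pos (hα : 1 < α) : 0 < α.conjExponent :=
  (Real.HolderConjugate.conjExponent hα).symm.pos

lemma mono (hα : 1 < α) (h : RenyiLE α ρ μ ν) (hρ : ρ ≤ ρ') : RenyiLE α ρ' μ ν := by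
  intro f hf
  have hq := conjExponent_pos hα
  refine (h f hf).trans ?_
  gcongr

lemma map (h : RenyiLE α ρ μ ν) {g : Ω → Ω'} (hg : Measurable g) :
    RenyiLE α ρ (μ.map g) (ν.map g) := by
  intro f hf
  rw [lintegral_map hf hg, lintegral_map (hf.pow_const _) hg]
  exact h _ (hf.comp hg)

/-- Adaptive composition: if a second mechanism takes the outcome of the first one as input, and
its bound is uniform in that input, then the Rényi bounds add up. -/
lemma compProd (hα : 1 < α) [SFinite μ] [SFinite ν] {κ η : Kernel Ω Ω'} [IsSFiniteKernel κ]
    [IsSFiniteKernel η] (h : RenyiLE α ρ μ ν) (h' : ∀ x, RenyiLE α ρ' (κ x) (η x)) :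
    RenyiLE α (ρ + ρ') (μ ⊗ₘ κ) (ν ⊗ₘ η) := by
  intro f hf
  have hq := conjExponent_pos hα
  have hf' := hf.pow_const α.conjExponent
  rw [Measure.lintegral_compProd hf, Measure.lintegral_compProd hf']
  have hmeas : Measurable fun x => ∫⁻ y, f (x, y) ^ α.conjExponent ∂η x :=
    hf'.lintegral_kernel_prod_right'
  refine (lintegral_mono fun x => h' x _ (hf.comp measurable_prodMk_left)).trans
    ((h _ ((hmeas.const_mul _).pow_const _)).trans_eq ?_)
  simp only [ENNReal.rpow_inv_rpow hq.ne']
  rw [lintegral_const_mul _ hmeas, ← mul_assoc, ← ENNReal.ofReal_mul (Real.exp_nonneg _),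
    ← Real.exp_add]

lemma prod (hα : 1 < α) [SFinite μ] [SFinite ν] {μ' ν' : Measure Ω'} [SFinite μ'] [SFinite ν']
    (h : RenyiLE α ρ μ ν) (h' : RenyiLE α ρ' μ' ν') :
    RenyiLE α (ρ + ρ') (μ.prod μ') (ν.prod ν') := by
  rw [← Measure.compProd_const, ← Measure.compProd_const]
  exact h.compProd hα fun _ => h'

/-- A bound on the `α`-th moment of the likelihood ratio, which is the usual definition of the Rényi
divergence, gives the dual bound. -/
lemma withDensity (hα : 1 < α) {g : Ω → ℝ≥0∞} (hg : Measurable g)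
    (h : ∫⁻ x, g x ^ α ∂ν ≤ ENNReal.ofReal (Real.exp ((α - 1) * ρ))) :
    RenyiLE α ρ (ν.withDensity g) ν := by
  intro f hf
  have hpq := Real.HolderConjugate.conjExponent hα
  have hα0 : 0 < α := by linarith
  rw [lintegral_withDensity_eq_lintegral_mul _ hg hf]
  refine (ENNReal.lintegral_mul_le_Lp_mul_Lq ν hpq hg.aemeasurable hf.aemeasurable).trans ?_
  rw [ENNReal.mul_rpow_of_nonneg _ _ (inv_nonneg.2 hpq.symm.nonneg), one_div, one_div]
  refine mul_le_mul_left ?_ _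
  calc (∫⁻ x, g x ^ α ∂ν) ^ α⁻¹
      ≤ ENNReal.ofReal (Real.exp ((α - 1) * ρ)) ^ α⁻¹ := by gcongr
    _ = ENNReal.ofReal (Real.exp ρ) ^ α.conjExponent⁻¹ := by
      rw [ENNReal.ofReal_rpow_of_pos (Real.exp_pos _), ENNReal.ofReal_rpow_of_pos (Real.exp_pos _),
        ← Real.exp_mul, ← Real.exp_mul, Real.conjExponent, inv_div]
      congr 2
      ring

lemma refl (hα : 1 < α) [IsProbabilityMeasure μ] : RenyiLE α 0 μ μ := by
  have h := withDensity (ν := μ) (ρ := 0) hα (g := 1) measurable_one (by simp)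
  rwa [withDensity_one] at h

/-- For product measures the Rényi bounds add up, as a special case of adaptive composition. -/
lemma pi_fin (hα : 1 < α) {n : ℕ} {μ ν : Fin n → Measure Ω} [∀ i, SigmaFinite (μ i)]
    [∀ i, SigmaFinite (ν i)] {ρ : Fin n → ℝ} (h : ∀ i, RenyiLE α (ρ i) (μ i) (ν i)) :
    RenyiLE α (∑ i, ρ i) (Measure.pi μ) (Measure.pi ν) := by
  induction n with
  | zero =>
    rw [Fin.sum_univ_zero, Measure.pi_of_empty, Measure.pi_of_empty]
    exact refl hα
  | succ n ih =>
    rw [Fin.sum_univ_succAbove _ 0,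
      ← (measurePreserving_piFinSuccAbove μ 0).symm.map_eq,
      ← (measurePreserving_piFinSuccAbove ν 0).symm.map_eq]
    exact ((h 0).prod hα (ih fun i => h _)).map (MeasurableEquiv.measurable _)

lemma pi {ι : Type*} [Fintype ι] (hα : 1 < α) {μ ν : ι → Measure Ω} [∀ i, SigmaFinite (μ i)]
    [∀ i, SigmaFinite (ν i)] {ρ : ι → ℝ} (h : ∀ i, RenyiLE α (ρ i) (μ i) (ν i)) :
    RenyiLE α (∑ i, ρ i) (Measure.pi μ) (Measure.pi ν) := by
  let e := (Fintype.equivFin ι).symm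
  rw [← e.sum_comp, ← (measurePreserving_piCongrLeft μ e).map_eq,
    ← (measurePreserving_piCongrLeft ν e).map_eq]
  exact (pi_fin hα fun i => h (e i)).map (MeasurableEquiv.measurable _)

/-- Two Gaussian laws of variance `v` with means `a` and `b` have Rényi divergence
`α (a - b)² / (2v)`: the moment of the likelihood ratio is a value of the moment generating
function. -/
lemma of_gaussianReal (hα : 1 < α) {v : ℝ≥0} (hv : v ≠ 0) (a b : ℝ) :
    RenyiLE α (α * (a - b) ^ 2 / (2 * v)) (gaussianReal a v) (gaussianReal b v) := by
  have hv' : (v : ℝ) ≠ 0 := by exact_mod_cast hv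
  set g : ℝ → ℝ≥0∞ := fun x =>
    ENNReal.ofReal (Real.exp ((a - b) / v * x - (a ^ 2 - b ^ 2) / (2 * v))) with hg_def
  have hg : Measurable g := by fun_prop
  have hdens : gaussianReal a v = (gaussianReal b v).withDensity g := by
    rw [gaussianReal_of_var_ne_zero _ hv, gaussianReal_of_var_ne_zero _ hv,
      ← withDensity_mul _ (measurable_gaussianPDF _ _) hg]
    congr 1
    funext x
    rw [Pi.mul_apply, gaussianPDF, gaussianPDF,
      ← ENNReal.ofReal_mul (gaussianPDFReal_nonneg _ _ _), gaussianPDFReal, gaussianPDFReal,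
      mul_assoc (√_)⁻¹, ← Real.exp_add]
    congr 3
    field_simp
    ring
  rw [hdens]
  refine withDensity hα hg (le_of_eq ?_)
  have hpow : ∀ x, g x ^ α = ENNReal.ofReal (Real.exp (-(α * (a ^ 2 - b ^ 2) / (2 * v)))) *
      ENNReal.ofReal (Real.exp (α * (a - b) / v * x)) := by
    intro x
    rw [hg_def, ENNReal.ofReal_rpow_of_pos (Real.exp_pos _), ← Real.exp_mul,
      ← ENNReal.ofReal_mul (Real.exp_nonneg _), ← Real.exp_add]
    congr 2
    ring
  have hmgf := congrFun (mgf_id_gaussianReal (μ := b) (v := v)) (α * (a - b) / v)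
  rw [mgf] at hmgf
  simp only [id_eq] at hmgf
  simp_rw [hpow]
  rw [lintegral_const_mul _ (by fun_prop),
    ← ofReal_integral_eq_lintegral_ofReal (integrable_exp_mul_gaussianReal _)
      (ae_of_all _ fun _ => Real.exp_nonneg _), hmgf, ← ENNReal.ofReal_mul (Real.exp_nonneg _),
    ← Real.exp_add]
  congr 2
  field_simp
  ring

/-- Conversion of a Rényi bound into `(ε, δ)`-differential privacy with
`ε = ρ + log (1/δ) / (α - 1)`, for all test functions with values in `[0, 1]`. -/
lemma lintegral_le (hα : 1 < α) (h : RenyiLE α ρ μ ν) {δ : ℝ} (hδ : 0 < δ) {f : Ω → ℝ≥0∞}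
    (hf : Measurable f) (hf1 : ∀ x, f x ≤ 1) :
    ∫⁻ x, f x ∂μ ≤ ENNReal.ofReal (Real.exp (ρ + Real.log (1 / δ) / (α - 1))) * ∫⁻ x, f x ∂ν +
      ENNReal.ofReal δ := by
  have hpq := Real.HolderConjugate.conjExponent hα
  have hq := conjExponent_pos hα
  have hα1 : 0 < α - 1 := by linarith
  have hα0 : 0 < α := by linarith
  -- Since `f ≤ 1`, the power `f ^ q` may be replaced by `f`.
  have hE : ∫⁻ x, f x ∂μ ≤
      (ENNReal.ofReal (Real.exp ρ) * ∫⁻ x, f x ∂ν) ^ (α.conjExponent)⁻¹ := by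
    refine (h f hf).trans ?_
    gcongr with x
    exact ENNReal.rpow_le_self_of_le_one (hf1 x) hpq.symm.lt.le
  set c := ENNReal.ofReal δ ^ α.conjExponent with hc
  have hc0 : c ≠ 0 := by simp [hc, hδ]
  set t := ENNReal.ofReal (Real.exp ρ) * ∫⁻ x, f x ∂ν with ht
  -- If `e^ρ ∫ f dν ≤ δ ^ q`, the bound is at most `δ`. Otherwise, as `1/q = 1 - 1/α`, the factor
  -- `(e^ρ ∫ f dν) ^ (-1/α)` is at most `δ ^ (-q/α) = e ^ (log (1/δ) / (α - 1))`.
  rcases le_total t c with htc | htc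
  · refine le_add_left (hE.trans ?_)
    calc t ^ (α.conjExponent)⁻¹ ≤ c ^ (α.conjExponent)⁻¹ := by gcongr
      _ = _ := ENNReal.rpow_rpow_inv hq.ne' _
  · refine le_add_right (hE.trans ?_)
    have ht0 : t ≠ 0 := fun h0 => hc0 (by simpa [h0] using htc)
    rcases eq_or_ne t ∞ with htop | htop
    · have : ∫⁻ x, f x ∂ν = ∞ := by
        by_contra hne
        exact ENNReal.mul_ne_top ENNReal.ofReal_ne_top hne htop
      rw [this, ENNReal.mul_top (by simp [Real.exp_pos])]
      exact le_top
    have hinv : (α.conjExponent)⁻¹ = 1 + (-α⁻¹) := by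
      rw [Real.conjExponent]
      field_simp
      ring
    calc t ^ (α.conjExponent)⁻¹ = t * t ^ (-α⁻¹) := by
          rw [hinv, ENNReal.rpow_add _ _ ht0 htop, ENNReal.rpow_one]
      _ ≤ t * c ^ (-α⁻¹) := by
          refine mul_le_mul_right ?_ _
          rw [ENNReal.rpow_neg, ENNReal.rpow_neg, ENNReal.inv_le_inv]
          gcongr
      _ = _ := by
          have : c ^ (-α⁻¹) = ENNReal.ofReal (Real.exp (Real.log (1 / δ) / (α - 1))) := by
            rw [hc, ← ENNReal.rpow_mul, ENNReal.ofReal_rpow_of_pos hδ, Real.rpow_def_of_pos hδ,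
              Real.conjExponent, one_div, Real.log_inv]
            congr 2
            field_simp
          rw [this, ht, Real.exp_add, ENNReal.ofReal_mul (Real.exp_nonneg _)]
          ring

end RenyiLE

/-! ### The Gaussian mechanism on matrices -/

/-- The law of a matrix with independent `N(0, σ²)` entries, the noise of a single hop. -/
noncomputable def gaussianMatrix (V : Type*) [Fintype V] (m : ℕ) (σ : ℝ) :
    Measure (NodeMatrix V m) :=
  Measure.pi fun _ => Measure.pi fun _ => gaussianReal 0 (Real.toNNReal (σ ^ 2))

instance {V : Type*} [Fintype V] (m : ℕ) (σ : ℝ) :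
    IsProbabilityMeasure (gaussianMatrix V m σ) := by
  unfold gaussianMatrix; infer_instance

section

variable {V : Type*} [Fintype V]

lemma gaussianMatrix_map_const_add {m : ℕ} (σ : ℝ) (B : NodeMatrix V m) :
    (gaussianMatrix V m σ).map (B + ·) =
      Measure.pi fun v => Measure.pi fun j => gaussianReal (B v j) (Real.toNNReal (σ ^ 2)) := by
  have hrow : ∀ v, Measure.pi (fun j => gaussianReal (B v j) (Real.toNNReal (σ ^ 2))) =
      (Measure.pi fun _ : Fin m => gaussianReal 0 (Real.toNNReal (σ ^ 2))).map (B v + ·) := by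
    intro v
    have := Measure.pi_map_pi (μ := fun _ : Fin m => gaussianReal 0 (Real.toNNReal (σ ^ 2)))
      (f := fun j x => B v j + x) (fun j => (measurable_const_add _).aemeasurable)
    simp only [gaussianReal_map_const_add, zero_add] at this
    exact this.symm
  simp_rw [hrow]
  exact Measure.pi_map_pi (fun v => (measurable_const_add _).aemeasurable)

/-- The Gaussian mechanism: the Rényi bound for two noisy matrices is proportional to the squared
Frobenius distance of their means. -/
lemma RenyiLE.gaussianMatrix_map_const_add {α σ : ℝ} (hα : 1 < α) (hσ : 0 < σ) {m : ℕ}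
    (B B' : NodeMatrix V m) :
    RenyiLE α (α * (∑ v, ∑ j, (B v j - B' v j) ^ 2) / (2 * σ ^ 2))
      ((gaussianMatrix V m σ).map (B + ·)) ((gaussianMatrix V m σ).map (B' + ·)) := by
  have hσ2 : 0 < σ ^ 2 := by positivity
  rw [_root_.gaussianMatrix_map_const_add, _root_.gaussianMatrix_map_const_add]
  have h := RenyiLE.pi hα fun v => RenyiLE.pi hα fun j =>
    RenyiLE.of_gaussianReal hα (Real.toNNReal_pos.2 hσ2).ne' (B v j) (B' v j)
  simpa only [Real.coe_toNNReal _ hσ2.le, ← Finset.sum_div, ← Finset.mul_sum] using h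

/-! ### Sensitivity of the aggregation -/

lemma sum_sq_rowNormalize_le_one {V : Type*} {m : ℕ} (X : NodeMatrix V m) (v : V) :
    ∑ j, rowNormalize X v j ^ 2 ≤ 1 := by
  simp only [rowNormalize, div_pow, ← Finset.sum_div, EuclideanSpace.real_norm_sq_eq]
  -- For a zero row the quotient is `0 / 0 = 0`.
  exact div_self_le_one _

/-- Removing the edge `u → w` subtracts the row `u` of `X` from the row `w` of `Aᵀ X`. -/
lemma aggregate_sub_removeEdge {m : ℕ} (G : Digraph V) {u w : V} (h : G.Adj u w)
    (X : NodeMatrix V m) (v : V) (j : Fin m) [Decidable (v = w)] :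
    aggregate G X v j - aggregate (G.removeEdge u w) X v j = if v = w then X u j else 0 := by
  classical
  have hterm : ∀ x, (G.adjacencyMatrix x v - (G.removeEdge u w).adjacencyMatrix x v) * X x j =
      if x = u then (if v = w then X u j else 0) else 0 := by
    intro x
    by_cases hx : x = u <;> by_cases hv : v = w <;>
      simp [Digraph.adjacencyMatrix, Digraph.removeEdge, hx, hv, h]
  simp only [aggregate, Matrix.mul_apply, Matrix.of_apply, Matrix.transpose_apply,
    ← Finset.sum_sub_distrib, ← sub_mul, hterm]
  simp

lemma sum_sq_aggregate_sub_removeEdge {m : ℕ} (G : Digraph V) {u w : V} (h : G.Adj u w)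
    (X : NodeMatrix V m) :
    ∑ v, ∑ j, (aggregate G X v j - aggregate (G.removeEdge u w) X v j) ^ 2 = ∑ j, X u j ^ 2 := by
  classical
  simp only [aggregate_sub_removeEdge G h]
  rw [Finset.sum_eq_single w (fun v _ hv => by simp [hv]) (by simp)]
  simp

/-- The sum aggregation of a matrix with rows of norm at most `1` has edge-level sensitivity `1` in
the Frobenius norm. -/
lemma GraphDataset.EdgeAdjacent.sum_sq_aggregate_sub_le {d C m : ℕ} {D D' : GraphDataset V d C}
    (h : D.EdgeAdjacent D') (X : NodeMatrix V m) (hX : ∀ v, ∑ j, X v j ^ 2 ≤ 1) :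
    ∑ v, ∑ j, (aggregate D.graph X v j - aggregate D'.graph X v j) ^ 2 ≤ 1 := by
  rcases h with ⟨u, w, huw, rfl⟩ | ⟨u, w, huw, rfl⟩
  · exact (sum_sq_aggregate_sub_removeEdge _ huw X).trans_le (hX u)
  · simp_rw [sub_sq_comm (aggregate (D'.graph.removeEdge u w) X _ _)]
    exact (sum_sq_aggregate_sub_removeEdge _ huw X).trans_le (hX u)

/-! ### Composition over the hops -/

/-- Private multi-hop aggregation with `K + 1` hops is the adaptive composition of one noisy
aggregation and of `K` further hops that start at its normalized outcome. The first component is kept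
before normalization, so that every value of it is a valid input of the kernel that follows. -/
lemma pma_succ {m : ℕ} (G : Digraph V) (K : ℕ) (σ : ℝ) (X : NodeMatrix V m) :
    pma G (K + 1) σ X =
      (((gaussianMatrix V m σ).map (aggregate G X + ·)) ⊗ₘ
        (pmaKernel m G K σ).comap rowNormalize measurable_rowNormalize).map
        fun p => (Fin.cons (rowNormalize p.1) p.2 : Fin (K + 1) → NodeMatrix V m) := by
  have hcons : Measurable fun p : NodeMatrix V m × (Fin K → NodeMatrix V m) =>
      (Fin.cons (rowNormalize p.1) p.2 : Fin (K + 1) → NodeMatrix V m) :=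
    (measurable_finCons K).comp
      ((measurable_rowNormalize.comp measurable_fst).prodMk measurable_snd)
  have hrun : ∀ (k : ℕ) (Y : NodeMatrix V m), Measurable (pmaRun G k Y) := fun k Y =>
    (measurable_pmaRun G k).comp measurable_prodMk_left
  have hnoise : gaussianNoise V m (K + 1) σ =
      ((gaussianMatrix V m σ).prod (gaussianNoise V m K σ)).map
        (MeasurableEquiv.piFinSuccAbove (fun _ => NodeMatrix V m) 0).symm :=
    (measurePreserving_piFinSuccAbove (fun _ : Fin (K + 1) => gaussianMatrix V m σ)
      0).symm.map_eq.symm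
  have hadd : Measurable (aggregate G X + · : NodeMatrix V m → NodeMatrix V m) :=
    measurable_const_add _
  ext S hS
  rw [Measure.map_apply hcons hS, Measure.compProd_apply (hcons hS),
    lintegral_map (Kernel.measurable_kernel_prodMk_left (hcons hS)) hadd, pma, hnoise,
    Measure.map_map (hrun _ _) (MeasurableEquiv.measurable _),
    Measure.map_apply ((hrun _ _).comp (MeasurableEquiv.measurable _)) hS,
    Measure.prod_apply (((hrun _ _).comp (MeasurableEquiv.measurable _)) hS)]
  refine lintegral_congr fun Z => ?_
  rw [Kernel.comap_apply]
  change _ = (gaussianNoise V m K σ).map _ _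
  rw [Measure.map_apply (hrun _ _) (measurable_prodMk_left (hcons hS))]
  rfl

/-- Each of the `K` hops contributes `α / (2σ²)` to the Rényi bound between the outputs of private
multi-hop aggregation on adjacent datasets. -/
lemma GraphDataset.EdgeAdjacent.renyiLE_pma {d C m : ℕ} {D D' : GraphDataset V d C}
    (h : D.EdgeAdjacent D') {α σ : ℝ} (hα : 1 < α) (hσ : 0 < σ) (K : ℕ) (X : NodeMatrix V m)
    (hX : ∀ v, ∑ j, X v j ^ 2 ≤ 1) :
    RenyiLE α (K * (α / (2 * σ ^ 2))) (pma D.graph K σ X) (pma D'.graph K σ X) := by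
  induction K generalizing X with
  | zero =>
    rw [Nat.cast_zero, zero_mul]
    -- Without hops both mechanisms are the same constant.
    have : IsProbabilityMeasure (pma D'.graph 0 σ X) :=
      inferInstanceAs (IsProbabilityMeasure (pmaKernel m D'.graph 0 σ X))
    change RenyiLE α 0 (pma D'.graph 0 σ X) (pma D'.graph 0 σ X)
    exact RenyiLE.refl hα
  | succ K ih =>
    have hcons : Measurable fun p : NodeMatrix V m × (Fin K → NodeMatrix V m) =>
        (Fin.cons (rowNormalize p.1) p.2 : Fin (K + 1) → NodeMatrix V m) :=
      (measurable_finCons K).comp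
        ((measurable_rowNormalize.comp measurable_fst).prodMk measurable_snd)
    rw [pma_succ, pma_succ]
    refine RenyiLE.map ?_ hcons
    have hstep : RenyiLE α (α / (2 * σ ^ 2))
        ((gaussianMatrix V m σ).map (aggregate D.graph X + ·))
        ((gaussianMatrix V m σ).map (aggregate D'.graph X + ·)) := by
      refine (RenyiLE.gaussianMatrix_map_const_add hα hσ _ _).mono hα ?_
      gcongr
      exact mul_le_of_le_one_right (by linarith) (h.sum_sq_aggregate_sub_le X hX)
    have := hstep.compProd hα (κ := (pmaKernel m D.graph K σ).comap rowNormalize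
      measurable_rowNormalize) (η := (pmaKernel m D'.graph K σ).comap rowNormalize
      measurable_rowNormalize) fun Y => ih (rowNormalize Y) (sum_sq_rowNormalize_le_one Y)
    convert this using 1
    push_cast
    ring

/-! ### Privacy of the training algorithm -/

lemma lintegral_privateAggregates {d C K : ℕ} (M : GAPModel V d C K) (σ : ℝ)
    (D : GraphDataset V d C) (θ : M.EncParams) {f : M.ClsData → ℝ≥0∞} (hf : Measurable f) :
    ∫⁻ x, f x ∂(privateAggregates M σ D θ) =
      ∫⁻ x, f (Fin.cons (rowNormalize (M.encode D.features θ)) x, D.labels)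
        ∂(pma D.graph K σ (rowNormalize (M.encode D.features θ))) := by
  have h : Measurable fun p : NodeMatrix V M.embDim × (Fin K → NodeMatrix V M.embDim) =>
      ((Fin.cons p.1 p.2 : Fin (K + 1) → NodeMatrix V M.embDim), D.labels) :=
    (measurable_finCons K).prodMk measurable_const
  rw [privateAggregates, Kernel.comap_apply, Kernel.map_apply _ h, lintegral_map hf h,
    Kernel.prod_apply, Kernel.id_apply]
  change ∫⁻ p, (f ∘ fun p : NodeMatrix V M.embDim × (Fin K → NodeMatrix V M.embDim) =>
    (Fin.cons p.1 p.2, D.labels)) p ∂_ = _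
  rw [lintegral_prod _ (hf.comp h).aemeasurable,
    lintegral_dirac' _ (hf.comp h).lintegral_prod_right']
  rfl

/-- The privacy guarantee of the training algorithm before the optimization over the order `α`. -/
lemma GraphDataset.EdgeAdjacent.gapTraining_le {d C K : ℕ} {D D' : GraphDataset V d C}
    (hD : D.EdgeAdjacent D') (M : GAPModel V d C K) (T₁ : Trainer M.PretrainData M.PretrainParams)
    (T₂ : Trainer M.ClsData M.ClsParams) {α σ δ : ℝ} (hα : 1 < α) (hσ : 0 < σ) (hδ : 0 < δ)
    {S : Set (M.EncParams × M.ClsParams)} (hS : MeasurableSet S) :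
    gapTraining M T₁ T₂ σ D S ≤
      ENNReal.ofReal (Real.exp (K * (α / (2 * σ ^ 2)) + Real.log (1 / δ) / (α - 1))) *
        gapTraining M T₁ T₂ σ D' S + ENNReal.ofReal δ := by
  have hfeat : D.features = D'.features := by
    rcases hD with ⟨u, w, -, rfl⟩ | ⟨u, w, -, rfl⟩ <;> rfl
  have hlab : D.labels = D'.labels := by
    rcases hD with ⟨u, w, -, rfl⟩ | ⟨u, w, -, rfl⟩ <;> rfl
  have hpre : pretrainedEncoder M T₁ D = pretrainedEncoder M T₁ D' := by
    rw [pretrainedEncoder, pretrainedEncoder, hfeat, hlab]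
  rw [gapTraining, gapTraining, Measure.compProd_apply hS, Measure.compProd_apply hS, hpre,
    ← lintegral_const_mul _ (Kernel.measurable_kernel_prodMk_left hS)]
  -- The encoder parameters have the same law for both datasets, so it suffices to compare the
  -- training of the classification module for each value of them.
  calc _ ≤ ∫⁻ θ, (_ * (T₂.train M.clsObjective ∘ₖ privateAggregates M σ D') θ
              (Prod.mk θ ⁻¹' S) + ENNReal.ofReal δ) ∂(pretrainedEncoder M T₁ D') :=
        lintegral_mono fun θ => ?_
    _ = _ := by
        rw [lintegral_add_right _ measurable_const, lintegral_const, measure_univ, mul_one]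
  have hSθ : MeasurableSet (Prod.mk θ ⁻¹' S) := measurable_prodMk_left hS
  have hf := (T₂.train M.clsObjective).measurable_coe hSθ
  have hcons : Measurable fun x : Fin K → NodeMatrix V M.embDim =>
      ((Fin.cons (rowNormalize (M.encode D'.features θ)) x : Fin (K + 1) → NodeMatrix V M.embDim),
        D'.labels) :=
    ((measurable_finCons K).comp measurable_prodMk_left).prodMk measurable_const
  rw [Kernel.comp_apply' _ _ _ hSθ, Kernel.comp_apply' _ _ _ hSθ,
    lintegral_privateAggregates _ _ _ _ hf, lintegral_privateAggregates _ _ _ _ hf, hfeat, hlab]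
  exact (hD.renyiLE_pma hα hσ K _ (sum_sq_rowNormalize_le_one _)).lintegral_le hα hδ
    (hf.comp hcons) fun _ => prob_le_one

end

theorem proposition2 {V : Type*} [Fintype V] (d C K : ℕ) (hK : 1 ≤ K)
    (M : GAPModel V d C K) (T₁ : Trainer M.PretrainData M.PretrainParams)
    (T₂ : Trainer M.ClsData M.ClsParams) (σ : ℝ) (hσ : 0 < σ)
    (δ : ℝ) (hδ : δ ∈ Set.Ioo (0 : ℝ) 1) :
    IsEdgeLevelDP (gapTraining M T₁ T₂ σ)
      (K / (2 * σ ^ 2) + √(2 * K * Real.log (1 / δ)) / σ) δ := by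
  intro D D' hD S hS
  have hL : 0 < Real.log (1 / δ) := Real.log_pos (one_lt_one_div hδ.1 hδ.2)
  have hK0 : (0 : ℝ) < K := by exact_mod_cast hK
  set s := √(2 * K * Real.log (1 / δ)) with hs
  have hs0 : 0 < s := Real.sqrt_pos.2 (by positivity)
  have hs2 : Real.log (1 / δ) = s ^ 2 / (2 * K) := by
    rw [hs, Real.sq_sqrt (by positivity)]
    field_simp
  -- The order minimizing `K α / (2σ²) + log (1/δ) / (α - 1)` is `α = 1 + σ s / K`.
  have hα : 1 < 1 + σ * s / K := by
    have : 0 < σ * s / K := by positivity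
    linarith
  have hε : K / (2 * σ ^ 2) + s / σ = K * ((1 + σ * s / K) / (2 * σ ^ 2)) +
      Real.log (1 / δ) / (1 + σ * s / K - 1) := by
    rw [hs2]
    field_simp
    ring
  rw [hε]
  exact hD.gapTraining_le M T₁ T₂ hα hσ hδ.1 hS
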